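/- A $\mathcal{C}^\infty$-ring is a set $A$ together with, for every $n\in\mathbb{N}$ and every smooth $f:\mathbb{R}^n\to\mathbb{R}$, an operation $A(f):A^n\to A$ such that $A(p_k)(a_1,\dots,a_n)=a_k$ for every coordinate projection $p_k:\mathbb{R}^n\to\mathbb{R}$, and $A(h\circ(g_1,\dots,g_n))=A(h)\circ(A(g_1),\dots,A(g_n))$ for all smooth $h:\mathbb{R}^n\to\mathbb{R}$ and $g_1,\dots,g_n:\mathbb{R}^m\to\mathbb{R}$. A $\mathcal{C}^\infty$-homomorphism is a map commuting with all these operations. The interpretations of $x+y$, $xy$, $-x$, $0$, $1$ make $A$ a commutative ring; $A^\times$ denotes its group of units. $A$ is *free* if there are a set $E$ and a map $\iota:E\to A$ such that every map from $E$ to a $\mathcal{C}^\infty$-ring $B$ extends uniquely along $\iota$ to a $\mathcal{C}^\infty$-homomorphism $A\to B$. $A$ is a *$\mathcal{C}^\infty$-domain* if its underlying ring is an integral domain. For $S\subseteq A$, the $\mathcal{C}^\infty$-ring of fractions $\eta_S:A\to A\{S^{-1}\}$ is the universal $\mathcal{C}^\infty$-homomorphism sending every element of $S$ to a unit. The $\mathcal{C}^\infty$-radical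 of an ideal $I\subseteq A$ is $\sqrt[\infty]{I}=\{a\in A : (A/I)\{(a+I)^{-1}\}\cong 0\}$, and $A$ is *$\mathcal{C}^\infty$-reduced* if $\sqrt[\infty]{(0)}=(0)$. **Proposition.** Let $A$ be a $\mathcal{C}^\infty$-ring such that either 1. $A$ is a free $\mathcal{C}^\infty$-ring, or 2. $A$ is a $\mathcal{C}^\infty$-reduced $\mathcal{C}^\infty$-domain. Then $$A^\times=(A^\times)^2\cup-(A^\times)^2,$$ where $(A^\times)^2=\{u^2:u\in A^\times\}$ and $-(A^\times)^2=\{-u^2:u\in A^\times\}$. -/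

import Mathlib

open scoped ContDiff

universe u v

/-- Smooth real functions of `n` real variables, `C^∞(ℝⁿ, ℝ)`. -/
structure SmoothFun (n : ℕ) where
  toFun : (Fin n → ℝ) → ℝ
  smooth : ContDiff ℝ ∞ toFun

namespace SmoothFun

/-- The `k`-th projection `ℝⁿ → ℝ`. -/
def proj {n : ℕ} (k : Fin n) : SmoothFun n where
  toFun x := x k
  smooth := by fun_prop

/-- The composite `h ∘ (g₁, …, gₙ)`. -/
def comp {n m : ℕ} (h : SmoothFun n) (g : Fin n → SmoothFun m) : SmoothFun m where
  toFun x := h.toFun (fun i => (g i).toFun x)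
  smooth := h.smooth.comp (contDiff_pi.2 fun i => (g i).smooth)

/-- The constant function `c` of `n` variables. -/
def const (n : ℕ) (c : ℝ) : SmoothFun n where
  toFun _ := c
  smooth := contDiff_const

/-- Addition `(x, y) ↦ x + y` as a smooth function. -/
def addFun : SmoothFun 2 where
  toFun x := x 0 + x 1
  smooth := by fun_prop

/-- Multiplication `(x, y) ↦ x * y` as a smooth function. -/
def mulFun : SmoothFun 2 where
  toFun x := x 0 * x 1
  smooth := by fun_prop

/-- Negation `x ↦ -x` as a smooth function. -/
def negFun : SmoothFun 1 where
  toFun x := - x 0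
  smooth := by fun_prop

theorem ext' {n : ℕ} {f g : SmoothFun n} (h : ∀ x, f.toFun x = g.toFun x) : f = g := by
  cases f; cases g; congr; exact funext h

end SmoothFun

/-- A `C^∞`-ring: a set `A` with an interpretation `Aⁿ → A` of every smooth function `ℝⁿ → ℝ`
(for every `n : ℕ`) that preserves projections and all composites. -/
class CInftyRing (A : Type u) where
  op : {n : ℕ} → SmoothFun n → (Fin n → A) → A
  op_proj : ∀ {n : ℕ} (k : Fin n) (a : Fin n → A), op (SmoothFun.proj k) a = a k
  op_comp : ∀ {n m : ℕ} (h : SmoothFun n) (g : Fin n → SmoothFun m) (a : Fin m → A),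
    op (h.comp g) a = op h (fun i => op (g i) a)

namespace CInftyRing

section UnderlyingRing

set_option linter.unusedSimpArgs false

variable {A : Type u} [CInftyRing A]

theorem op_const {m : ℕ} (c : ℝ) (a : Fin m → A) :
    op (SmoothFun.const m c) a = op (SmoothFun.const 0 c) (fun i : Fin 0 => i.elim0) := by
  have h := op_comp (SmoothFun.const 0 c) (fun i : Fin 0 => (i.elim0 : SmoothFun m)) a
  rw [show (SmoothFun.const 0 c).comp (fun i : Fin 0 => (i.elim0 : SmoothFun m))
    = SmoothFun.const m c from rfl] at h
  rw [h]
  congr 1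
  funext i
  exact i.elim0

theorem op_comp_two {m : ℕ} (h : SmoothFun 2) (f g : SmoothFun m) (a : Fin m → A) :
    op h ![op f a, op g a] = op (h.comp ![f, g]) a := by
  rw [op_comp]
  congr 1
  funext i
  fin_cases i <;> rfl

theorem op_comp_one {m : ℕ} (h : SmoothFun 1) (f : SmoothFun m) (a : Fin m → A) :
    op h ![op f a] = op (h.comp ![f]) a := by
  rw [op_comp]
  congr 1
  funext i
  fin_cases i; rfl

theorem op_congr {m : ℕ} {f g : SmoothFun m} (h : ∀ x, f.toFun x = g.toFun x) (a : Fin m → A) :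
    op f a = op g a := by
  rw [SmoothFun.ext' h]

theorem law_add_assoc {m : ℕ} (f g h : SmoothFun m) (a : Fin m → A) :
    op SmoothFun.addFun ![op SmoothFun.addFun ![op f a, op g a], op h a]
      = op SmoothFun.addFun ![op f a, op SmoothFun.addFun ![op g a, op h a]] := by
  simp only [← op_const _ a, op_comp_two, op_comp_one]
  refine op_congr (fun x => ?_) a
  simp [SmoothFun.comp, SmoothFun.addFun, SmoothFun.mulFun, SmoothFun.negFun, SmoothFun.const]
  ring

theorem law_add_comm {m : ℕ} (f g : SmoothFun m) (a : Fin m → A) :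
    op SmoothFun.addFun ![op f a, op g a]
      = op SmoothFun.addFun ![op g a, op f a] := by
  simp only [← op_const _ a, op_comp_two, op_comp_one]
  refine op_congr (fun x => ?_) a
  simp [SmoothFun.comp, SmoothFun.addFun, SmoothFun.mulFun, SmoothFun.negFun, SmoothFun.const]
  ring

theorem law_zero_add {m : ℕ} (f : SmoothFun m) (a : Fin m → A) :
    op SmoothFun.addFun ![op (SmoothFun.const 0 0) (fun i : Fin 0 => i.elim0), op f a]
      = op f a := by
  simp only [← op_const _ a, op_comp_two, op_comp_one]
  refine op_congr (fun x => ?_) a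
  simp [SmoothFun.comp, SmoothFun.addFun, SmoothFun.mulFun, SmoothFun.negFun, SmoothFun.const]

theorem law_add_zero {m : ℕ} (f : SmoothFun m) (a : Fin m → A) :
    op SmoothFun.addFun ![op f a, op (SmoothFun.const 0 0) (fun i : Fin 0 => i.elim0)]
      = op f a := by
  simp only [← op_const _ a, op_comp_two, op_comp_one]
  refine op_congr (fun x => ?_) a
  simp [SmoothFun.comp, SmoothFun.addFun, SmoothFun.mulFun, SmoothFun.negFun, SmoothFun.const]

theorem law_neg_add_cancel {m : ℕ} (f : SmoothFun m) (a : Fin m → A) :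
    op SmoothFun.addFun ![op SmoothFun.negFun ![op f a], op f a]
      = op (SmoothFun.const 0 0) (fun i : Fin 0 => i.elim0) := by
  simp only [← op_const _ a, op_comp_two, op_comp_one]
  refine op_congr (fun x => ?_) a
  simp [SmoothFun.comp, SmoothFun.addFun, SmoothFun.mulFun, SmoothFun.negFun, SmoothFun.const]

theorem law_mul_assoc {m : ℕ} (f g h : SmoothFun m) (a : Fin m → A) :
    op SmoothFun.mulFun ![op SmoothFun.mulFun ![op f a, op g a], op h a]
      = op SmoothFun.mulFun ![op f a, op SmoothFun.mulFun ![op g a, op h a]] := by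
  simp only [← op_const _ a, op_comp_two, op_comp_one]
  refine op_congr (fun x => ?_) a
  simp [SmoothFun.comp, SmoothFun.addFun, SmoothFun.mulFun, SmoothFun.negFun, SmoothFun.const]
  ring

theorem law_mul_comm {m : ℕ} (f g : SmoothFun m) (a : Fin m → A) :
    op SmoothFun.mulFun ![op f a, op g a]
      = op SmoothFun.mulFun ![op g a, op f a] := by
  simp only [← op_const _ a, op_comp_two, op_comp_one]
  refine op_congr (fun x => ?_) a
  simp [SmoothFun.comp, SmoothFun.addFun, SmoothFun.mulFun, SmoothFun.negFun, SmoothFun.const]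
  ring

theorem law_one_mul {m : ℕ} (f : SmoothFun m) (a : Fin m → A) :
    op SmoothFun.mulFun ![op (SmoothFun.const 0 1) (fun i : Fin 0 => i.elim0), op f a]
      = op f a := by
  simp only [← op_const _ a, op_comp_two, op_comp_one]
  refine op_congr (fun x => ?_) a
  simp [SmoothFun.comp, SmoothFun.addFun, SmoothFun.mulFun, SmoothFun.negFun, SmoothFun.const]

theorem law_mul_one {m : ℕ} (f : SmoothFun m) (a : Fin m → A) :
    op SmoothFun.mulFun ![op f a, op (SmoothFun.const 0 1) (fun i : Fin 0 => i.elim0)]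
      = op f a := by
  simp only [← op_const _ a, op_comp_two, op_comp_one]
  refine op_congr (fun x => ?_) a
  simp [SmoothFun.comp, SmoothFun.addFun, SmoothFun.mulFun, SmoothFun.negFun, SmoothFun.const]

theorem law_zero_mul {m : ℕ} (f : SmoothFun m) (a : Fin m → A) :
    op SmoothFun.mulFun ![op (SmoothFun.const 0 0) (fun i : Fin 0 => i.elim0), op f a]
      = op (SmoothFun.const 0 0) (fun i : Fin 0 => i.elim0) := by
  simp only [← op_const _ a, op_comp_two, op_comp_one]
  refine op_congr (fun x => ?_) a
  simp [SmoothFun.comp, SmoothFun.addFun, SmoothFun.mulFun, SmoothFun.negFun, SmoothFun.const]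

theorem law_mul_zero {m : ℕ} (f : SmoothFun m) (a : Fin m → A) :
    op SmoothFun.mulFun ![op f a, op (SmoothFun.const 0 0) (fun i : Fin 0 => i.elim0)]
      = op (SmoothFun.const 0 0) (fun i : Fin 0 => i.elim0) := by
  simp only [← op_const _ a, op_comp_two, op_comp_one]
  refine op_congr (fun x => ?_) a
  simp [SmoothFun.comp, SmoothFun.addFun, SmoothFun.mulFun, SmoothFun.negFun, SmoothFun.const]

theorem law_left_distrib {m : ℕ} (f g h : SmoothFun m) (a : Fin m → A) :
    op SmoothFun.mulFun ![op f a, op SmoothFun.addFun ![op g a, op h a]]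
      = op SmoothFun.addFun
        ![op SmoothFun.mulFun ![op f a, op g a], op SmoothFun.mulFun ![op f a, op h a]] := by
  simp only [← op_const _ a, op_comp_two, op_comp_one]
  refine op_congr (fun x => ?_) a
  simp [SmoothFun.comp, SmoothFun.addFun, SmoothFun.mulFun, SmoothFun.negFun, SmoothFun.const]
  ring

theorem law_right_distrib {m : ℕ} (f g h : SmoothFun m) (a : Fin m → A) :
    op SmoothFun.mulFun ![op SmoothFun.addFun ![op f a, op g a], op h a]
      = op SmoothFun.addFun
        ![op SmoothFun.mulFun ![op f a, op h a], op SmoothFun.mulFun ![op g a, op h a]] := by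
  simp only [← op_const _ a, op_comp_two, op_comp_one]
  refine op_congr (fun x => ?_) a
  simp [SmoothFun.comp, SmoothFun.addFun, SmoothFun.mulFun, SmoothFun.negFun, SmoothFun.const]
  ring

/-- The underlying commutative ring of a `C^∞`-ring: the operations are the interpretations of
the smooth functions `x + y`, `x * y`, `-x` and of the constants `0` and `1`. -/
instance (priority := 100) toCommRing : CommRing A where
  add a b := op SmoothFun.addFun ![a, b]
  mul a b := op SmoothFun.mulFun ![a, b]
  neg a := op SmoothFun.negFun ![a]
  zero := op (SmoothFun.const 0 0) (fun i : Fin 0 => i.elim0)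
  one := op (SmoothFun.const 0 1) (fun i : Fin 0 => i.elim0)
  nsmul := @nsmulRec A ⟨op (SmoothFun.const 0 0) (fun i : Fin 0 => i.elim0)⟩
    ⟨fun a b => op SmoothFun.addFun ![a, b]⟩
  zsmul := @zsmulRec A ⟨op (SmoothFun.const 0 0) (fun i : Fin 0 => i.elim0)⟩
    ⟨fun a b => op SmoothFun.addFun ![a, b]⟩ ⟨fun a => op SmoothFun.negFun ![a]⟩
    (@nsmulRec A ⟨op (SmoothFun.const 0 0) (fun i : Fin 0 => i.elim0)⟩
      ⟨fun a b => op SmoothFun.addFun ![a, b]⟩)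
  add_assoc a b c := by
    have h := law_add_assoc (SmoothFun.proj 0) (SmoothFun.proj 1) (SmoothFun.proj 2) ![a, b, c]
    simp only [op_proj] at h
    exact h
  add_comm a b := by
    have h := law_add_comm (SmoothFun.proj 0) (SmoothFun.proj 1) ![a, b]
    simp only [op_proj] at h
    exact h
  zero_add a := by
    have h := law_zero_add (SmoothFun.proj 0) ![a]
    simp only [op_proj] at h
    exact h
  add_zero a := by
    have h := law_add_zero (SmoothFun.proj 0) ![a]
    simp only [op_proj] at h
    exact h
  neg_add_cancel a := by
    have h := law_neg_add_cancel (SmoothFun.proj 0) ![a]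
    simp only [op_proj] at h
    exact h
  mul_assoc a b c := by
    have h := law_mul_assoc (SmoothFun.proj 0) (SmoothFun.proj 1) (SmoothFun.proj 2) ![a, b, c]
    simp only [op_proj] at h
    exact h
  mul_comm a b := by
    have h := law_mul_comm (SmoothFun.proj 0) (SmoothFun.proj 1) ![a, b]
    simp only [op_proj] at h
    exact h
  one_mul a := by
    have h := law_one_mul (SmoothFun.proj 0) ![a]
    simp only [op_proj] at h
    exact h
  mul_one a := by
    have h := law_mul_one (SmoothFun.proj 0) ![a]
    simp only [op_proj] at h
    exact h
  zero_mul a := by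
    have h := law_zero_mul (SmoothFun.proj 0) ![a]
    simp only [op_proj] at h
    exact h
  mul_zero a := by
    have h := law_mul_zero (SmoothFun.proj 0) ![a]
    simp only [op_proj] at h
    exact h
  left_distrib a b c := by
    have h := law_left_distrib (SmoothFun.proj 0) (SmoothFun.proj 1) (SmoothFun.proj 2) ![a, b, c]
    simp only [op_proj] at h
    exact h
  right_distrib a b c := by
    have h := law_right_distrib (SmoothFun.proj 0) (SmoothFun.proj 1) (SmoothFun.proj 2) ![a, b, c]
    simp only [op_proj] at h
    exact h

end UnderlyingRing

end CInftyRing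

/-- A `C^∞`-homomorphism: a map commuting with the interpretations of all smooth functions. -/
structure CInftyHom (A : Type u) (B : Type v) [CInftyRing A] [CInftyRing B] where
  toFun : A → B
  map_op : ∀ {n : ℕ} (f : SmoothFun n) (a : Fin n → A),
    toFun (CInftyRing.op f a) = CInftyRing.op f (fun i => toFun (a i))

instance {A : Type u} {B : Type v} [CInftyRing A] [CInftyRing B] :
    CoeFun (CInftyHom A B) (fun _ => A → B) := ⟨CInftyHom.toFun⟩

namespace CInftyRing

/-- `ι : E → A` exhibits `A` as the free `C^∞`-ring on the set `E`: every map from `E` to a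
`C^∞`-ring `B` extends uniquely along `ι` to a `C^∞`-homomorphism `A → B`. -/
def IsFreeOn {E A : Type u} [CInftyRing A] (ι : E → A) : Prop :=
  ∀ (B : Type u) [CInftyRing B] (g : E → B), ∃! φ : CInftyHom A B, ∀ e, φ (ι e) = g e

/-- `A` is a free `C^∞`-ring (on some set of generators, of any cardinality). -/
def IsFree (A : Type u) [CInftyRing A] : Prop :=
  ∃ (E : Type u) (ι : E → A), IsFreeOn ι

/-- `η : A → L` is a `C^∞`-ring of fractions `A{S⁻¹}` of `A` with respect to the subset `S`. -/
def IsRingOfFractions {A L : Type u} [CInftyRing A] [CInftyRing L] (S : Set A)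
    (η : CInftyHom A L) : Prop :=
  (∀ s ∈ S, IsUnit (η s)) ∧
    ∀ (B : Type u) [CInftyRing B] (φ : CInftyHom A B), (∀ s ∈ S, IsUnit (φ s)) →
      ∃! ψ : CInftyHom L B, ∀ a, ψ (η a) = φ a

/-- `q : A → Q` is a quotient `C^∞`-ring `A/I`: a surjective `C^∞`-homomorphism with kernel `I`. -/
def IsQuotientBy {A Q : Type u} [CInftyRing A] [CInftyRing Q] (I : Ideal A)
    (q : CInftyHom A Q) : Prop :=
  Function.Surjective q ∧ ∀ a, q a = 0 ↔ a ∈ I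

/-- The `C^∞`-radical of an ideal `I`: all `a` such that `(A/I){(a + I)⁻¹}` is the zero ring.
Quotients and rings of fractions are unique up to isomorphism, so it does not matter which ones
are used. -/
def cInftyRadical {A : Type u} [CInftyRing A] (I : Ideal A) : Set A :=
  {a | ∃ (Q : Type u) (_ : CInftyRing Q) (q : CInftyHom A Q)
      (L : Type u) (_ : CInftyRing L) (η : CInftyHom Q L),
      IsQuotientBy I q ∧ IsRingOfFractions {q a} η ∧ Subsingleton L}

/-- `A` is `C^∞`-reduced: the `C^∞`-radical of the zero ideal is the zero ideal. -/
def IsCInftyReduced (A : Type u) [CInftyRing A] : Prop :=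
  cInftyRadical (⊥ : Ideal A) = ((⊥ : Ideal A) : Set A)

/-- `A` is a `C^∞`-domain: its underlying commutative ring is an integral domain. -/
def IsCInftyDomain (A : Type u) [CInftyRing A] : Prop :=
  IsDomain A

end CInftyRing

namespace SmoothFun

/-- `C^∞(ℝⁿ, ℝ)` as a `C^∞`-ring, the operations being composition. -/
instance instCInftyRing (n : ℕ) : CInftyRing (SmoothFun n) where
  op h g := h.comp g
  op_proj _ _ := rfl
  op_comp _ _ _ := rfl

end SmoothFun

namespace CInftyHom

variable {A : Type u} {B : Type v} [CInftyRing A] [CInftyRing B]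

/-- A `C^∞`-homomorphism is a homomorphism of the underlying rings. -/
def toRingHom (φ : CInftyHom A B) : A →+* B where
  toFun := φ
  map_zero' := (φ.map_op (SmoothFun.const 0 0) _).trans
    (congrArg _ (funext fun i => i.elim0))
  map_one' := (φ.map_op (SmoothFun.const 0 1) _).trans
    (congrArg _ (funext fun i => i.elim0))
  map_add' a b := (φ.map_op SmoothFun.addFun ![a, b]).trans
    (congrArg _ (funext fun i => by fin_cases i <;> rfl))
  map_mul' a b := (φ.map_op SmoothFun.mulFun ![a, b]).trans
    (congrArg _ (funext fun i => by fin_cases i <;> rfl))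

end CInftyHom

namespace CInftyRing

variable {A : Type u} [CInftyRing A]

/-- Evaluation of smooth functions at a tuple of elements of a `C^∞`-ring. -/
def eval {n : ℕ} (a : Fin n → A) : CInftyHom (SmoothFun n) A where
  toFun f := op f a
  map_op f g := op_comp f g a

/-- Evaluation of smooth functions at a tuple, as a ring homomorphism. -/
def evalRingHom {n : ℕ} (a : Fin n → A) : SmoothFun n →+* A := (eval a).toRingHom

theorem evalRingHom_apply {n : ℕ} (a : Fin n → A) (f : SmoothFun n) :
    evalRingHom a f = op f a := rfl

@[simp] theorem evalRingHom_proj {n : ℕ} (a : Fin n → A) (k : Fin n) :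
    evalRingHom a (SmoothFun.proj k) = a k := op_proj k a

/-- The smooth step function applied to the sum of two variables. -/
noncomputable def stepSum : SmoothFun 2 where
  toFun x := Real.smoothTransition (x 0 + x 1)
  smooth := Real.smoothTransition.contDiff.comp (by fun_prop)

/-- A positive smooth function of one variable that is `4 - s ^ 2` for `s ^ 2 ≤ 1`. -/
noncomputable def gapAux (s : ℝ) : ℝ := 3 + (1 - s ^ 2) * Real.smoothTransition (2 - s ^ 2)

theorem gapAux_contDiff : ContDiff ℝ ∞ gapAux :=
  contDiff_const.add <| ContDiff.mul (by fun_prop)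
    (Real.smoothTransition.contDiff.comp (by fun_prop))

theorem gapAux_pos (s : ℝ) : 0 < gapAux s := by
  unfold gapAux
  rcases le_total (2 - s ^ 2) 0 with h | h
  · rw [Real.smoothTransition.zero_of_nonpos h]; norm_num
  · nlinarith [Real.smoothTransition.nonneg (2 - s ^ 2), Real.smoothTransition.le_one (2 - s ^ 2)]

theorem gapAux_eq {s : ℝ} (h : s ^ 2 ≤ 1) : gapAux s = 4 - s ^ 2 := by
  unfold gapAux
  rw [Real.smoothTransition.one_of_one_le (by linarith)]
  ring

/-- A positive smooth function of one variable that is `s + 2` for `-1 ≤ s`. -/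
noncomputable def shiftAux (s : ℝ) : ℝ := 1 + (s + 1) * Real.smoothTransition (2 * s + 3)

theorem shiftAux_contDiff : ContDiff ℝ ∞ shiftAux :=
  contDiff_const.add <| ContDiff.mul (by fun_prop)
    (Real.smoothTransition.contDiff.comp (by fun_prop))

theorem shiftAux_pos (s : ℝ) : 0 < shiftAux s := by
  unfold shiftAux
  rcases le_total (2 * s + 3) 0 with h | h
  · rw [Real.smoothTransition.zero_of_nonpos h]; norm_num
  · nlinarith [Real.smoothTransition.nonneg (2 * s + 3), Real.smoothTransition.le_one (2 * s + 3)]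

theorem shiftAux_eq {s : ℝ} (h : -1 ≤ s) : shiftAux s = s + 2 := by
  unfold shiftAux
  rw [Real.smoothTransition.one_of_one_le (by linarith)]
  ring

/-- A smooth function of `x` and `y` that is `(x + y + 2)^(-1/2)` for `-1 ≤ x + y`. -/
noncomputable def rootSum : SmoothFun 2 where
  toFun x := (Real.sqrt (shiftAux (x 0 + x 1)))⁻¹
  smooth := ((shiftAux_contDiff.comp (by fun_prop)).sqrt fun _ => (shiftAux_pos _).ne').inv
    fun _ => (Real.sqrt_pos.2 (shiftAux_pos _)).ne'

theorem rootSum_sq_mul {x : Fin 2 → ℝ} (h : -1 ≤ x 0 + x 1) :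
    rootSum.toFun x * rootSum.toFun x * (x 0 + x 1 + 2) = 1 := by
  rw [← shiftAux_eq h]
  change (Real.sqrt _)⁻¹ * (Real.sqrt _)⁻¹ * _ = 1
  rw [← mul_inv, Real.mul_self_sqrt (shiftAux_pos _).le]
  exact inv_mul_cancel₀ (shiftAux_pos _).ne'

/-- The reciprocal of `gapAux (x + y) + (x - y) ^ 2`. -/
noncomputable def gapInv : SmoothFun 2 where
  toFun x := (gapAux (x 0 + x 1) + (x 0 - x 1) ^ 2)⁻¹
  smooth := ((gapAux_contDiff.comp (by fun_prop)).add (by fun_prop)).inv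
    fun x => (add_pos_of_pos_of_nonneg (gapAux_pos _) (sq_nonneg _)).ne'

theorem stepSum_defect (x : Fin 2 → ℝ) :
    stepSum.toFun x * stepSum.toFun x + -stepSum.toFun x =
      (stepSum.toFun x * stepSum.toFun x + -stepSum.toFun x) * gapInv.toFun x *
        ((1 + 1 + 1 + 1) * (1 + -(x 0 * x 1))) := by
  by_cases h : 0 ≤ x 0 + x 1 ∧ x 0 + x 1 ≤ 1
  · have hg : gapInv.toFun x * ((1 + 1 + 1 + 1) * (1 + -(x 0 * x 1))) = 1 := by
      have hs : gapAux (x 0 + x 1) + (x 0 - x 1) ^ 2 = (1 + 1 + 1 + 1) * (1 + -(x 0 * x 1)) := by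
        rw [gapAux_eq (by nlinarith [h.1, h.2])]; ring
      rw [← hs]
      exact inv_mul_cancel₀ (add_pos_of_pos_of_nonneg (gapAux_pos _) (sq_nonneg _)).ne'
    rw [mul_assoc, hg, mul_one]
  · have hz : stepSum.toFun x * stepSum.toFun x + -stepSum.toFun x = 0 := by
      change Real.smoothTransition _ * Real.smoothTransition _ + -Real.smoothTransition _ = 0
      rcases lt_or_ge (x 0 + x 1) 0 with h0 | h0
      · rw [Real.smoothTransition.zero_of_nonpos h0.le]; norm_num
      · rw [Real.smoothTransition.one_of_one_le (le_of_not_ge fun h1 => h ⟨h0, h1⟩)]; norm_num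
    rw [hz]; ring

/-- The step function evaluated at `a + a⁻¹` is idempotent. -/
theorem isIdempotentElem_stepSum {a b : A} (hab : a * b = 1) :
    IsIdempotentElem (op stepSum ![a, b]) := by
  have h : stepSum * stepSum + -stepSum = (stepSum * stepSum + -stepSum) * gapInv *
      ((1 + 1 + 1 + 1) * (1 + -(SmoothFun.proj 0 * SmoothFun.proj 1))) :=
    SmoothFun.ext' stepSum_defect
  have h' := congrArg (evalRingHom ![a, b]) h
  simp only [map_add, map_mul, map_neg, map_one, evalRingHom_proj] at h'
  simp only [Matrix.cons_val_zero, Matrix.cons_val_one, hab, add_neg_cancel, mul_zero] at h'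
  exact add_neg_eq_zero.1 h'

theorem exists_sq_of_rootSum {a b : A} (hab : a * b = 1)
    (h : op rootSum ![a, b] * op rootSum ![a, b] * (a + b + 1 + 1) = 1) :
    ∃ u : A, a = u ^ 2 :=
  ⟨(a + 1) * op rootSum ![a, b], by
    linear_combination (-a) * h + op rootSum ![a, b] ^ 2 * hab⟩

theorem exists_sq_of_stepSum_eq_one {a b : A} (hab : a * b = 1)
    (h : op stepSum ![a, b] = 1) : ∃ u : A, a = u ^ 2 := by
  have hf : stepSum * (rootSum * rootSum * (SmoothFun.proj 0 + SmoothFun.proj 1 + 1 + 1)) =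
      stepSum := by
    refine SmoothFun.ext' fun x => ?_
    change Real.smoothTransition (x 0 + x 1) *
      (rootSum.toFun x * rootSum.toFun x * (x 0 + x 1 + 1 + 1)) = Real.smoothTransition (x 0 + x 1)
    rcases le_total (x 0 + x 1) 0 with hx | hx
    · rw [Real.smoothTransition.zero_of_nonpos hx, zero_mul]
    · rw [add_assoc _ (1 : ℝ) 1, one_add_one_eq_two, rootSum_sq_mul (by linarith), mul_one]
  have h' := congrArg (evalRingHom ![a, b]) hf
  simp only [map_add, map_mul, map_one, evalRingHom_proj] at h'
  rw [evalRingHom_apply _ stepSum, h, one_mul] at h'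
  exact exists_sq_of_rootSum hab h'

theorem stepSum_neg_mul (x : Fin 2 → ℝ) :
    (1 + -stepSum.toFun x) * (rootSum.toFun (fun i => -x i) * rootSum.toFun (fun i => -x i) *
      (-x 0 + -x 1 + 1 + 1)) = 1 + -stepSum.toFun x := by
  change (1 + -Real.smoothTransition (x 0 + x 1)) * _ = 1 + -Real.smoothTransition (x 0 + x 1)
  rcases le_total 1 (x 0 + x 1) with hx | hx
  · rw [Real.smoothTransition.one_of_one_le hx, add_neg_cancel, zero_mul]
  · have := rootSum_sq_mul (x := fun i => -x i) (by linarith)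
    rw [add_assoc _ (1 : ℝ) 1, one_add_one_eq_two, this, mul_one]

theorem exists_neg_sq_of_stepSum_eq_zero {a b : A} (hab : a * b = 1)
    (h : op stepSum ![a, b] = 0) : ∃ u : A, a = -(u ^ 2) := by
  let r : SmoothFun 2 := rootSum.comp fun i => -SmoothFun.proj i
  have hf : (1 + -stepSum) * (r * r * (-SmoothFun.proj 0 + -SmoothFun.proj 1 + 1 + 1)) =
      1 + -stepSum := SmoothFun.ext' stepSum_neg_mul
  have hr : evalRingHom ![a, b] r = op rootSum ![-a, -b] := by
    rw [evalRingHom_apply, op_comp]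
    congr 1
    funext i
    rw [← evalRingHom_apply, map_neg, evalRingHom_proj]
    fin_cases i <;> rfl
  have h' := congrArg (evalRingHom ![a, b]) hf
  simp only [map_add, map_mul, map_one, map_neg, evalRingHom_proj, hr] at h'
  rw [evalRingHom_apply _ stepSum, h, neg_zero, add_zero, one_mul] at h'
  obtain ⟨u, hu⟩ := exists_sq_of_rootSum (a := -a) (b := -b) (by rw [neg_mul_neg, hab]) h'
  exact ⟨u, by rw [← hu, neg_neg]⟩

/-- In a `C^∞`-ring with only trivial idempotents, every unit is a square up to sign. -/
theorem setOf_isUnit_eq (hA : ∀ e : A, IsIdempotentElem e → e = 0 ∨ e = 1) :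
    {a : A | IsUnit a}
      = {a : A | ∃ u : A, IsUnit u ∧ a = u ^ 2} ∪
        {a : A | ∃ u : A, IsUnit u ∧ a = -(u ^ 2)} := by
  ext a
  constructor
  · intro ha
    obtain ⟨b, hab⟩ := IsUnit.exists_right_inv ha
    rcases hA _ (isIdempotentElem_stepSum hab) with h | h
    · obtain ⟨u, rfl⟩ := exists_neg_sq_of_stepSum_eq_zero hab h
      exact Or.inr ⟨u, (isUnit_pow_iff two_ne_zero).1 (IsUnit.neg_iff _ |>.1 ha), rfl⟩
    · obtain ⟨u, rfl⟩ := exists_sq_of_stepSum_eq_one hab h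
      exact Or.inl ⟨u, (isUnit_pow_iff two_ne_zero).1 ha, rfl⟩
  · rintro (⟨u, hu, rfl⟩ | ⟨u, hu, rfl⟩)
    · exact hu.pow 2
    · exact (hu.pow 2).neg

/-- The real numbers as a `C^∞`-ring in an arbitrary universe. -/
abbrev realULift : CInftyRing (ULift.{u} ℝ) where
  op f x := ⟨f.toFun fun i => (x i).down⟩
  op_proj _ _ := rfl
  op_comp _ _ _ := rfl

/-- The elements that are smooth functions of finitely many members of a family. -/
def generated {E : Type u} (ι : E → A) : Set A :=
  {a | ∃ (k : ℕ) (f : SmoothFun k) (e : Fin k → E), a = op f fun i => ι (e i)}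

theorem op_mem_generated {E : Type u} (ι : E → A) {n : ℕ} (f : SmoothFun n) (a : Fin n → A)
    (ha : ∀ i, a i ∈ generated ι) : op f a ∈ generated ι := by
  choose k g e h using ha
  let q : (Σ i, Fin (k i)) ≃ Fin (∑ i, k i) := finSigmaFinEquiv
  refine ⟨_, f.comp fun i => (g i).comp fun j => SmoothFun.proj (q ⟨i, j⟩),
    fun j => e (q.symm j).1 (q.symm j).2, ?_⟩
  rw [op_comp]
  congr 1
  funext i
  rw [op_comp, h i]
  congr 1
  funext j
  exact ((op_proj _ _).trans
    (congrArg (fun p : Σ i, Fin (k i) => ι (e p.1 p.2)) (q.symm_apply_apply ⟨i, j⟩))).symm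

/-- The `C^∞`-subring generated by a family. -/
abbrev generatedRing {E : Type u} (ι : E → A) : CInftyRing (generated ι) where
  op f a := ⟨op f fun i => (a i : A), op_mem_generated ι f _ fun i => (a i).2⟩
  op_proj k _ := Subtype.ext (op_proj k _)
  op_comp h g _ := Subtype.ext (op_comp h g _)

/-- A free `C^∞`-ring is generated by its basis. -/
theorem IsFreeOn.mem_generated {E : Type u} {ι : E → A} (hι : IsFreeOn ι) (a : A) :
    a ∈ generated ι := by
  let _ := generatedRing ι
  have hmem : ∀ e, ι e ∈ generated ι := fun e =>
    ⟨1, SmoothFun.proj 0, fun _ => e, (op_proj 0 fun _ => ι e).symm⟩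
  obtain ⟨φ, hφ, -⟩ := hι (generated ι) fun e => ⟨ι e, hmem e⟩
  let ψ : CInftyHom A A := ⟨fun x => (φ x : A), fun f x => congrArg Subtype.val (φ.map_op f x)⟩
  have h : ψ = ⟨id, fun _ _ => rfl⟩ :=
    (hι A ι).unique (fun e => congrArg Subtype.val (hφ e)) fun _ => rfl
  have ha : ((φ a : generated ι) : A) = a := congrArg (fun χ : CInftyHom A A => χ a) h
  exact ha ▸ (φ a).2

/-- The members of the generating family can be taken distinct. -/
theorem exists_injective_of_mem_generated {E : Type u} {ι : E → A} {a : A}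
    (ha : a ∈ generated ι) :
    ∃ (k : ℕ) (f : SmoothFun k) (e : Fin k → E),
      Function.Injective e ∧ a = op f fun i => ι (e i) := by
  obtain ⟨k, f, e, rfl⟩ := ha
  let q := Finite.equivFin (Set.range e)
  refine ⟨_, f.comp fun i => SmoothFun.proj (q ⟨e i, Set.mem_range_self i⟩), fun j => (q.symm j : E),
    Subtype.val_injective.comp q.symm.injective, ?_⟩
  rw [op_comp]
  congr 1
  funext i
  simp only [op_proj, Equiv.symm_apply_apply]

/-- Distinct basis elements of a free `C^∞`-ring satisfy no smooth relation. -/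
theorem IsFreeOn.op_injective {E : Type u} {ι : E → A} (hι : IsFreeOn ι) {k : ℕ}
    {e : Fin k → E} (he : Function.Injective e) :
    Function.Injective fun f : SmoothFun k => op f fun i => ι (e i) := by
  intro f g hfg
  refine SmoothFun.ext' fun x => ?_
  let _ := realULift.{u}
  obtain ⟨φ, hφ, -⟩ := hι (ULift.{u} ℝ) fun z => ⟨Function.extend e x 0 z⟩
  have h := congrArg φ hfg
  simp only [φ.map_op, hφ, he.extend_apply] at h
  exact congrArg ULift.down h

theorem _root_.SmoothFun.eq_zero_or_one {n : ℕ} {f : SmoothFun n} (hf : IsIdempotentElem f) :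
    f = 0 ∨ f = 1 := by
  have h01 : ∀ x, f.toFun x = 0 ∨ f.toFun x = 1 := fun x =>
    IsIdempotentElem.iff_eq_zero_or_one.1 (congrArg (fun g : SmoothFun n => g.toFun x) hf)
  have hconst : ∀ x y, f.toFun x = f.toFun y := fun x y =>
    isPreconnected_univ.constant_of_mapsTo (T := ({0, 1} : Set ℝ))
      (Set.toFinite _).isDiscrete f.smooth.continuous.continuousOn (fun x _ => h01 x) trivial trivial
  exact (h01 0).imp (fun h => SmoothFun.ext' fun x => (hconst x 0).trans h)
    fun h => SmoothFun.ext' fun x => (hconst x 0).trans h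

/-- A free `C^∞`-ring has only trivial idempotents. -/
theorem IsFree.eq_zero_or_one (hA : IsFree A) (a : A) (ha : IsIdempotentElem a) :
    a = 0 ∨ a = 1 := by
  obtain ⟨E, ι, hι⟩ := hA
  obtain ⟨k, f, e, he, rfl⟩ := exists_injective_of_mem_generated (hι.mem_generated a)
  have hf : IsIdempotentElem f := hι.op_injective he
    (((evalRingHom fun i => ι (e i)).map_mul f f).trans ha)
  refine (SmoothFun.eq_zero_or_one hf).imp ?_ ?_
  · rintro rfl; exact (evalRingHom fun i => ι (e i)).map_zero
  · rintro rfl; exact (evalRingHom fun i => ι (e i)).map_one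

end CInftyRing

theorem proposition3p14 {A : Type u} [CInftyRing A]
    (hA : CInftyRing.IsFree A ∨ (CInftyRing.IsCInftyReduced A ∧ CInftyRing.IsCInftyDomain A)) :
    {a : A | IsUnit a}
      = {a : A | ∃ u : A, IsUnit u ∧ a = u ^ 2} ∪ {a : A | ∃ u : A, IsUnit u ∧ a = -(u ^ 2)} := by
  refine CInftyRing.setOf_isUnit_eq ?_
  rcases hA with hA | ⟨-, hA⟩
  · exact hA.eq_zero_or_one
  · have : IsDomain A := hA
    exact fun _ => IsIdempotentElem.iff_eq_zero_or_one.1
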